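/- All topological spaces are Hausdorff. A space is *semiregular* if it has a base of regular open sets ($U=\operatorname{int}\operatorname{cl}U$), and *pseudocompact* if each locally finite open cover is finite. A *semitopological* semigroup has a separately continuous multiplication. For a monoid $S$ with zero and a cardinal $\lambda\ge 1$, the Brandt $\lambda^0$-extension is $B^0_\lambda(S)=\{0\}\cup\{(\alpha,s,\beta):\alpha,\beta\in\lambda,\ s\in S\setminus\{0_S\}\}$ with $(\alpha,s,\beta)(\gamma,t,\delta)=(\alpha,st,\delta)$ if $\beta=\gamma$, and $=0$ if $\beta\ne\gamma$; here $0$ is a zero and $(\alpha,0_S,\beta)$ is read as $0$. A semiregular pseudocompact topological Brandt $\lambda^0$-extension of a semitopological monoid $(S,\tau)$ with zero is $B^0_\lambda(S)$ with a Hausdorff semiregular pseudocompact topology that makes the multiplication separately continuous and, for some $\alpha\in\lambda$, induces $\tau$ on $S_{\alpha,\alpha}=\{(\alpha,s,\alpha):s\in S\}\cong S$. For $\lambda\ge2$, a semigroup $S$ with zero has the $\mathcal B^*_\lambda$-property if it contains no copy of the semigroup $B_\lambda=B^0_\lambda(\{0,1\})$ of $\lambda\times\lambda$-matrix units, and no copy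 of $B_2$ whose zero is the zero of $S$; it has the $\mathcal B^*$-property if this holds for every cardinal $\lambda\ge2$. Let $\mathfrak{PCTB}$ be the class of semiregular pseudocompact semitopological monoids $S$ with zero such that $S$ has the $\mathcal B^*$-property and every idempotent of $S$ is central. For an idempotent $e$ let $H(e)$ be the maximal subgroup with unit $e$. The category $\mathscr{TPCB}$ has as objects the pairs $(S,\lambda)$ with $S\in\mathfrak{PCTB}$ and $\lambda$ a nonzero cardinal. Its morphisms $(S,\lambda)\to(S',\lambda')$ are one zero morphism and the triples $(h,u,\varphi)$, where $h:S\to S'$ is a continuous homomorphism with $h(0_S)=0_{S'}$ that is nontrivial (not identically $0_{S'}$), $u:\lambda\to H(h(1_S))$ is a map, and $\varphi:\lambda\to\lambda'$ is injective. The composition is $$(h,u,\varphi)(h',u',\varphi')=\bigl(h'\circ h,\ \alpha\mapsto u'(\varphi(\alpha))\,h'(u(\alpha)),\ \varphi'\circ\varphi\bigr)$$ if $h'\circ h$ is nontrivial, and every other composite is the zero morphism; thus all pairs $(S,\lambda)$ with $S=\{0\}$ are zero objects. The identity of $(S,\lambda)$ is $(\mathrm{Id}_S,\alpha\mapsto 1_S,\mathrm{Id}_\lambda)$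 if $S\ne\{0\}$, and the zero morphism otherwise. The category $\mathscr B^*(\mathscr{TPCS})$ has as objects all semiregular pseudocompact topological Brandt $\lambda^0$-extensions of monoids $S\in\mathfrak{PCTB}$, $\lambda\ge1$, and as morphisms all continuous homomorphisms that preserve zero. **Theorem.** Each $(S,\lambda)\in\mathscr{TPCB}$ has exactly one semiregular pseudocompact topological Brandt $\lambda^0$-extension $\mathbf B(S,\lambda)=B^0_\lambda(S)$. For a triple $(h,u,\varphi):(S,\lambda)\to(S',\lambda')$ as above put $\mathbf B(h,u,\varphi)(0)=0$ and $$\mathbf B(h,u,\varphi)(\alpha,s,\beta)=\begin{cases}(\varphi(\alpha),\,u(\alpha)\,h(s)\,u(\beta)^{-1},\,\varphi(\beta)),& h(s)\neq 0_{S'},\\ 0,& h(s)=0_{S'},\end{cases}$$ and let $\mathbf B$ send zero morphisms to zero maps. Then $\mathbf B$ is a functor from $\mathscr{TPCB}$ to $\mathscr B^*(\mathscr{TPCS})$, it is full, and it is representative: every object of $\mathscr B^*(\mathscr{TPCS})$ is isomorphic to some $\mathbf B(S,\lambda)$. -/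

import Mathlib

open CategoryTheory Topology

universe u

section Topological

variable (X : Type u) [TopologicalSpace X]

/-- A space is semiregular if it has a base consisting of regular open sets. -/
def IsSemiregular : Prop :=
  ∃ ℬ : Set (Set X), TopologicalSpace.IsTopologicalBasis ℬ ∧
    ∀ U ∈ ℬ, interior (closure U) = U

/-- A space is pseudocompact if each locally finite open cover is finite. -/
def IsPseudocompact : Prop :=
  ∀ 𝒰 : Set (Set X), (∀ U ∈ 𝒰, IsOpen U) → ⋃₀ 𝒰 = Set.univ →
    LocallyFinite (fun U : 𝒰 => (U : Set X)) → 𝒰.Finite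

end Topological

/-- Continuous homomorphisms that preserve zero. The unit need not be preserved. -/
@[ext]
structure CHom₀ (S T : Type u) [Mul S] [Zero S] [TopologicalSpace S]
    [Mul T] [Zero T] [TopologicalSpace T] where
  toFun : S → T
  map_mul : ∀ x y, toFun (x * y) = toFun x * toFun y
  map_zero : toFun 0 = 0
  continuous : Continuous toFun

namespace CHom₀

instance {S T : Type u} [Mul S] [Zero S] [TopologicalSpace S]
    [Mul T] [Zero T] [TopologicalSpace T] : CoeFun (CHom₀ S T) (fun _ => S → T) :=
  ⟨CHom₀.toFun⟩

/-- The identity homomorphism. -/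
def id (S : Type u) [Mul S] [Zero S] [TopologicalSpace S] : CHom₀ S S where
  toFun := fun x => x
  map_mul _ _ := rfl
  map_zero := rfl
  continuous := continuous_id

/-- First `f`, then `g`. -/
def comp {S T R : Type u} [Mul S] [Zero S] [TopologicalSpace S]
    [Mul T] [Zero T] [TopologicalSpace T] [Mul R] [Zero R] [TopologicalSpace R]
    (f : CHom₀ S T) (g : CHom₀ T R) : CHom₀ S R where
  toFun := fun x => g (f x)
  map_mul x y := by rw [f.map_mul, g.map_mul]
  map_zero := by rw [f.map_zero, g.map_zero]
  continuous := g.continuous.comp f.continuous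

end CHom₀

/-- The Brandt extension with zero of `S` over the index set `ι`: the Rees quotient of
`(ι × S × ι) ∪ {0}` by the ideal `{0} ∪ {(α, 0, β)}`. Its elements are a zero and the triples
`(α, s, β)` with `s ≠ 0`. -/
inductive Brandt (ι S : Type u) [Zero S] : Type u
  | zero : Brandt ι S
  | elem (α : ι) (s : S) (hs : s ≠ 0) (β : ι) : Brandt ι S

namespace Brandt

variable {ι S : Type u}

instance [Zero S] : Zero (Brandt ι S) := ⟨zero⟩

open Classical in
/-- The class of `(α, s, β)` in the Rees quotient, for any `s` (so `(α, 0, β)` gives `0`). -/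
noncomputable def entry [Zero S] (α : ι) (s : S) (β : ι) : Brandt ι S :=
  if h : s = 0 then 0 else elem α s h β

open Classical in
noncomputable instance [MonoidWithZero S] : Mul (Brandt ι S) where
  mul
    | elem α s _ β, elem γ t _ δ => if β = γ then entry α (s * t) δ else 0
    | _, _ => 0

section

variable [MonoidWithZero S]

theorem zero_def : (zero : Brandt ι S) = 0 := rfl

theorem elem_eq_entry (α : ι) (s : S) (hs : s ≠ 0) (β : ι) : elem α s hs β = entry α s β := by
  simp [entry, hs]

theorem entry_zero (α β : ι) : (entry α (0 : S) β) = 0 := by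
  simp [entry]

protected theorem zero_mul' (x : Brandt ι S) : 0 * x = 0 := by
  cases x <;> rfl

protected theorem mul_zero' (x : Brandt ι S) : x * 0 = 0 := by
  cases x <;> rfl

theorem entry_mul_entry_same (α β δ : ι) (s t : S) :
    entry α s β * entry β t δ = entry α (s * t) δ := by
  by_cases hs : s = 0
  · simp [hs, entry_zero, Brandt.zero_mul']
  by_cases ht : t = 0
  · simp [ht, entry_zero, Brandt.mul_zero']
  rw [← elem_eq_entry α s hs, ← elem_eq_entry β t ht]
  exact if_pos rfl

theorem entry_mul_entry_of_ne (α : ι) {β γ : ι} (δ : ι) (s t : S) (h : β ≠ γ) :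
    entry α s β * entry γ t δ = 0 := by
  by_cases hs : s = 0
  · simp [hs, entry_zero, Brandt.zero_mul']
  by_cases ht : t = 0
  · simp [ht, entry_zero, Brandt.mul_zero']
  rw [← elem_eq_entry α s hs, ← elem_eq_entry γ t ht]
  exact if_neg h

noncomputable instance : SemigroupWithZero (Brandt ι S) where
  zero_mul := Brandt.zero_mul'
  mul_zero := Brandt.mul_zero'
  mul_assoc x y z := by
    rcases x with _ | ⟨α, s, hs, β⟩
    · simp only [zero_def, Brandt.zero_mul']
    rcases y with _ | ⟨γ, t, ht, δ⟩
    · simp only [zero_def, Brandt.zero_mul', Brandt.mul_zero']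
    rcases z with _ | ⟨μ, r, hr, ν⟩
    · simp only [zero_def, Brandt.mul_zero']
    simp only [elem_eq_entry]
    by_cases h₁ : β = γ
    · subst h₁
      by_cases h₂ : δ = μ
      · subst h₂
        simp only [entry_mul_entry_same, mul_assoc]
      · simp only [entry_mul_entry_same, entry_mul_entry_of_ne _ _ _ _ h₂, Brandt.mul_zero']
    · by_cases h₂ : δ = μ
      · subst h₂
        simp only [entry_mul_entry_same, entry_mul_entry_of_ne _ _ _ _ h₁, Brandt.zero_mul']
      · simp only [entry_mul_entry_of_ne _ _ _ _ h₁, entry_mul_entry_of_ne _ _ _ _ h₂,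
          Brandt.zero_mul', Brandt.mul_zero']

end

end Brandt

/-- The semigroup of `ι × ι` matrix units: the Brandt extension of the two-element
monoid `{0, 1}`. -/
abbrev MatrixUnits (ι : Type u) : Type u := Brandt ι (WithZero PUnit.{u + 1})

/-- The `𝓑*_λ`-property, with `λ` the cardinality of `ι`. -/
def HasBStarAt (S : Type u) [MonoidWithZero S] (ι : Type u) : Prop :=
  (¬ ∃ f : MatrixUnits ι →ₙ* S, Function.Injective f) ∧
  ¬ ∃ f : MatrixUnits (ULift.{u} (Fin 2)) →ₙ* S, Function.Injective f ∧ f 0 = 0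

/-- The `𝓑*`-property: the `𝓑*_λ`-property for every cardinal `λ ≥ 2`. -/
def HasBStar (S : Type u) [MonoidWithZero S] : Prop :=
  ∀ ι : Type u, Nontrivial ι → HasBStarAt S ι

/-- `τ` makes the Brandt extension of `S` over `ι` a semiregular pseudocompact topological Brandt
extension of `S` in the class of (Hausdorff) semitopological semigroups. -/
structure IsBrandtExtension (S : Type u) [MonoidWithZero S] [TopologicalSpace S] (ι : Type u)
    (τ : TopologicalSpace (Brandt ι S)) : Prop where
  t2 : T2Space (Brandt ι S)
  separatelyContinuous : SeparatelyContinuousMul (Brandt ι S)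
  semiregular : IsSemiregular (Brandt ι S)
  pseudocompact : IsPseudocompact (Brandt ι S)
  inducing : ∃ α : ι, IsInducing (fun s : S => (Brandt.entry α s α : Brandt ι S))

/-- Pairs `(S, λ)` of a (Hausdorff) semiregular pseudocompact semitopological monoid with zero
that has the `𝓑*`-property and central idempotents, and a nonzero cardinal, given as a
nonempty index set. -/
structure TPCB : Type (u + 1) where
  S : Type u
  [monoid : MonoidWithZero S]
  [top : TopologicalSpace S]
  [t2 : T2Space S]
  [separatelyContinuous : SeparatelyContinuousMul S]
  semiregular : IsSemiregular S
  pseudocompact : IsPseudocompact S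
  bStar : HasBStar S
  central : ∀ e : S, e * e = e → ∀ x : S, e * x = x * e
  index : Type u
  [nonempty : Nonempty index]

attribute [instance] TPCB.monoid TPCB.top TPCB.t2 TPCB.separatelyContinuous TPCB.nonempty

/-- `y` is the inverse of `x` in the maximal subgroup with unit `e`. -/
def IsInvAt {T : Type u} [Mul T] (e x y : T) : Prop :=
  e * y = y ∧ y * e = y ∧ x * y = e ∧ y * x = e

/-- The maximal subgroup `H(e)` of `T` with unit the idempotent `e`: the group of units of the
monoid `e T e`. -/
def maxSubgroup {T : Type u} [Mul T] (e : T) : Set T :=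
  {x | e * x = x ∧ x * e = x ∧ ∃ y, IsInvAt e x y}

open Classical in
/-- The inverse of `x` in `H(e)` (with value `e` if `x` is not in `H(e)`). -/
noncomputable def invAt {T : Type u} [Mul T] (e x : T) : T :=
  if h : ∃ y, IsInvAt e x y then h.choose else e

namespace TPCB

/-- A triple `(h, u, φ) : (S, λ) → (S', λ')`; here `u` takes values in `H(h(1))`. -/
@[ext]
structure Triple (X Y : TPCB.{u}) where
  h : CHom₀ X.S Y.S
  u : X.index → Y.S
  u_mem : ∀ α, u α ∈ maxSubgroup (h 1)
  φ : X.index → Y.index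
  φ_inj : Function.Injective φ

namespace Triple

/-- The identity triple `(Id, 1, Id)`. -/
def id (X : TPCB.{u}) : Triple X X where
  h := CHom₀.id X.S
  u := fun _ => 1
  u_mem := fun _ => by
    change (1 : X.S) ∈ maxSubgroup (1 : X.S)
    exact ⟨one_mul 1, one_mul 1, 1, one_mul 1, one_mul 1, one_mul 1, one_mul 1⟩
  φ := fun α => α
  φ_inj := fun _ _ h => h

/-- The composition `(h, u, φ)(h', u', φ') = (hh', α ↦ u'(φ(α)) · h'(u(α)), φφ')`. -/
def comp {X Y Z : TPCB.{u}} (p : Triple X Y) (q : Triple Y Z) : Triple X Z where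
  h := p.h.comp q.h
  u := fun α => q.u (p.φ α) * q.h (p.u α)
  u_mem := fun α => by
    change _ ∈ maxSubgroup (q.h (p.h 1))
    obtain ⟨a1, a2, a, a3, a4, a5, a6⟩ := q.u_mem (p.φ α)
    obtain ⟨b1, b2, b, b3, b4, b5, b6⟩ := p.u_mem α
    generalize q.u (p.φ α) = x at *
    generalize p.u α = y at *
    have c1 := congrArg q.h b1
    have c2 := congrArg q.h b2
    have c3 := congrArg q.h b3
    have c4 := congrArg q.h b4
    have c5 := congrArg q.h b5
    have c6 := congrArg q.h b6
    have hf : q.h (p.h 1) * q.h (p.h 1) = q.h (p.h 1) := by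
      rw [← q.h.map_mul, ← p.h.map_mul, one_mul]
    have hef : q.h 1 * q.h (p.h 1) = q.h (p.h 1) := by
      rw [← q.h.map_mul, one_mul]
    have hey : q.h 1 * q.h y = q.h y := by
      rw [← q.h.map_mul, one_mul]
    rw [q.h.map_mul] at c1 c2 c3 c4 c5 c6
    have hc := Z.central _ hf
    generalize q.h (p.h 1) = f at *
    generalize q.h y = y' at *
    generalize q.h b = b' at *
    generalize q.h 1 = e at *
    refine ⟨?_, ?_, b' * a, ?_, ?_, ?_, ?_⟩
    · rw [← mul_assoc, hc x, mul_assoc, c1]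
    · rw [mul_assoc, c2]
    · rw [← mul_assoc, c3]
    · rw [mul_assoc, ← hc a, ← mul_assoc, c4]
    · rw [mul_assoc, ← mul_assoc y', c5, hc a, ← mul_assoc, a5, hef]
    · rw [mul_assoc, ← mul_assoc a, a6, hey, c6]
  φ := fun α => q.φ (p.φ α)
  φ_inj := q.φ_inj.comp p.φ_inj

/-- The triple has a nontrivial homomorphism `h`. -/
def IsNontrivial {X Y : TPCB.{u}} (p : Triple X Y) : Prop := ∃ s, p.h s ≠ 0

theorem id_comp {X Y : TPCB.{u}} (p : Triple X Y) : (id X).comp p = p := by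
  ext α
  · rfl
  · exact (p.u_mem α).2.1
  · rfl

theorem comp_id {X Y : TPCB.{u}} (p : Triple X Y) : p.comp (id Y) = p := by
  ext α
  · rfl
  · exact one_mul _
  · rfl

theorem comp_assoc {X Y Z W : TPCB.{u}} (p : Triple X Y) (q : Triple Y Z) (r : Triple Z W) :
    (p.comp q).comp r = p.comp (q.comp r) := by
  ext α
  · rfl
  · change r.u _ * r.h (q.u _ * q.h _) = (r.u _ * r.h _) * r.h (q.h _)
    rw [r.h.map_mul, mul_assoc]
    rfl
  · rfl

end Triple

/-- Morphisms `(S, λ) → (S', λ')`: the triples `(h, u, φ)` with `h` nontrivial, and one zero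
morphism. The pairs `({0}, λ)` are identified, which makes them one zero object; every triple with
trivial `h` factors through it, and so does the zero morphism between any two pairs. -/
inductive Hom (X Y : TPCB.{u}) : Type u
  | zero : Hom X Y
  | triple (p : Triple X Y) (hp : p.IsNontrivial) : Hom X Y

namespace Hom

open Classical in
/-- The morphism given by an arbitrary triple: all triples with trivial `h` give the zero
morphism. -/
noncomputable def ofTriple {X Y : TPCB.{u}} (p : Triple X Y) : Hom X Y :=
  if hp : p.IsNontrivial then triple p hp else zero

/-- Composition, first `f` and then `g`. -/
noncomputable def comp {X Y Z : TPCB.{u}} : Hom X Y → Hom Y Z → Hom X Z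
  | triple p _, triple q _ => ofTriple (p.comp q)
  | _, _ => zero

theorem triple_eq {X Y : TPCB.{u}} (p : Triple X Y) (hp : p.IsNontrivial) :
    triple p hp = ofTriple p := by
  simp [ofTriple, hp]

theorem zero_comp {X Y Z : TPCB.{u}} (g : Hom Y Z) : (zero : Hom X Y).comp g = zero := by
  cases g <;> rfl

theorem comp_zero {X Y Z : TPCB.{u}} (f : Hom X Y) : f.comp (zero : Hom Y Z) = zero := by
  cases f <;> rfl

theorem ofTriple_comp {X Y Z : TPCB.{u}} (p : Triple X Y) (q : Triple Y Z) :
    (ofTriple p).comp (ofTriple q) = ofTriple (p.comp q) := by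
  by_cases hp : p.IsNontrivial
  · by_cases hq : q.IsNontrivial
    · rw [← triple_eq p hp, ← triple_eq q hq]
      rfl
    · have h : ¬ (p.comp q).IsNontrivial := fun ⟨s, hs⟩ => hq ⟨p.h s, hs⟩
      simp only [ofTriple, hq, h, dite_false, comp_zero]
  · have h : ¬ (p.comp q).IsNontrivial := fun ⟨s, hs⟩ => hp ⟨s, fun h0 => hs (by
      change q.h (p.h s) = 0
      rw [h0, q.h.map_zero])⟩
    simp only [ofTriple, hp, h, dite_false, zero_comp]

end Hom

noncomputable instance : Category.{u} TPCB.{u} where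
  Hom := Hom
  id X := Hom.ofTriple (Triple.id X)
  comp f g := Hom.comp f g
  id_comp f := by
    cases f with
    | zero => exact Hom.comp_zero _
    | triple p hp => rw [Hom.triple_eq, Hom.ofTriple_comp, Triple.id_comp]
  comp_id f := by
    cases f with
    | zero => exact Hom.zero_comp _
    | triple p hp => rw [Hom.triple_eq, Hom.ofTriple_comp, Triple.comp_id]
  assoc f g k := by
    cases f with
    | zero => simp only [Hom.zero_comp]
    | triple p hp =>
      cases g with
      | zero => simp only [Hom.zero_comp, Hom.comp_zero]
      | triple q hq =>
        cases k with
        | zero => simp only [Hom.comp_zero]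
        | triple r hr =>
          simp only [Hom.triple_eq, Hom.ofTriple_comp, Triple.comp_assoc]

open Classical in
/-- The map between Brandt extensions given by a triple:
`(α, s, β) ↦ (φ(α), u(α) · h(s) · u(β)⁻¹, φ(β))` if `h(s) ≠ 0`, and `(α, s, β) ↦ 0` if `h(s) = 0`;
`0 ↦ 0`. -/
noncomputable def Triple.brandtMap {X Y : TPCB.{u}} (p : Triple X Y) :
    Brandt X.index X.S → Brandt Y.index Y.S
  | .zero => 0
  | .elem α s _ β =>
    if p.h s = 0 then 0
    else Brandt.entry (p.φ α) (p.u α * p.h s * invAt (p.h 1) (p.u β)) (p.φ β)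

/-- The map between Brandt extensions given by a morphism; the zero morphism gives the zero
map. -/
noncomputable def brandtMap {X Y : TPCB.{u}} : (X ⟶ Y) → Brandt X.index X.S → Brandt Y.index Y.S
  | Hom.zero => fun _ => 0
  | Hom.triple p _ => p.brandtMap

end TPCB

/-- The semiregular pseudocompact topological Brandt extensions of the monoids `S` that occur in
`TPCB`: a pair `(S, λ)` with an admissible topology on its Brandt extension. -/
structure BTPCS : Type (u + 1) where
  pair : TPCB.{u}
  top : TopologicalSpace (Brandt pair.index pair.S)
  isBrandtExtension : IsBrandtExtension pair.S pair.index top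

namespace BTPCS

/-- The underlying semigroup. -/
abbrev Carrier (X : BTPCS.{u}) : Type u := Brandt X.pair.index X.pair.S

instance (X : BTPCS.{u}) : TopologicalSpace X.Carrier := X.top

noncomputable instance : Category.{u} BTPCS.{u} where
  Hom X Y := CHom₀ X.Carrier Y.Carrier
  id X := CHom₀.id X.Carrier
  comp f g := CHom₀.comp f g

/-- The map underlying a morphism. -/
def toMap {X Y : BTPCS.{u}} (f : X ⟶ Y) : X.Carrier → Y.Carrier := CHom₀.toFun f

end BTPCS

/-! View an element of the Brandt extension as a matrix with at most one nonzero entry. The initial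
topology of all matrix entries, `coordTopology`, is admissible: a basic neighbourhood of `0`
constrains finitely many entries, so everything outside it lies in finitely many blocks, and each
block is a continuous image of `S`.

It is the only admissible topology. Multiplying by matrix units makes every entry map and every
block inclusion continuous, so an admissible topology is at least as fine. Conversely, by
pseudocompactness a regular open neighbourhood of `0` contains all but finitely many blocks
(`finite_not_subset`), and semiregularity supplies enough such neighbourhoods (`eq_coordTopology`).
Hence every object of the target is literally in the image of the functor.

For fullness (`exists_brandtMap_eq`), a nonzero homomorphism sends `(α, 1, α)` to a nonzero diagonal
idempotent `(φ α, e α, φ α)`. Centrality of idempotents forces `φ` to be injective and all `e α` to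
coincide. Fixing an index `o`, the block `(o, o)` gives `h`, and the images of `(α, 1, o)` give `u`.
-/

open Set Filter

/-! ### Semiregular and pseudocompact spaces -/

section Spaces

variable {X : Type u} [TopologicalSpace X]

/-- A local form in which `O` need not be regular: `interior (closure O)` is itself regular open and
contains `O`. -/
theorem isSemiregular_iff : IsSemiregular X ↔
    ∀ (x : X) (W : Set X), IsOpen W → x ∈ W →
      ∃ O, IsOpen O ∧ x ∈ O ∧ interior (closure O) ⊆ W := by
  constructor
  · rintro ⟨ℬ, hB, hreg⟩ x W hW hx
    obtain ⟨V, hV, hxV, hVW⟩ := hB.exists_subset_of_mem_open hx hW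
    exact ⟨V, hB.isOpen hV, hxV, (hreg V hV).trans_subset hVW⟩
  · intro H
    refine ⟨{V | interior (closure V) = V}, ?_, fun V hV => hV⟩
    refine TopologicalSpace.isTopologicalBasis_of_isOpen_of_nhds ?_ ?_
    · intro V hV
      rw [← show interior (closure V) = V from hV]
      exact isOpen_interior
    · intro x W hx hW
      obtain ⟨O, hO, hxO, hOW⟩ := H x W hW hx
      exact ⟨interior (closure O), interior_closure_idem,
        hO.subset_interior_closure hxO, hOW⟩

theorem IsPseudocompact.finite_nonempty (hX : IsPseudocompact X) {κ : Type*} {U : κ → Set X}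
    (hU : ∀ i, IsOpen (U i)) (hf : LocallyFinite U) : {i | (U i).Nonempty}.Finite := by
  -- Adjoining `univ` turns the family into a cover without spoiling local finiteness.
  have hrange : (insert univ (range U)).Finite := by
    refine hX _ ?_ ?_ ?_
    · rintro V (rfl | ⟨i, rfl⟩)
      exacts [isOpen_univ, hU i]
    · exact univ_subset_iff.1 (subset_sUnion_of_mem (mem_insert _ _))
    · intro x
      obtain ⟨N, hN, hfin⟩ := hf x
      refine ⟨N, hN, ?_⟩
      refine Set.Finite.of_finite_image (f := Subtype.val) ?_ Subtype.val_injective.injOn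
      refine ((hfin.image U).insert univ).subset ?_
      rintro _ ⟨⟨V, rfl | ⟨i, rfl⟩⟩, hV, rfl⟩
      · exact mem_insert _ _
      · exact mem_insert_of_mem _ ⟨i, hV, rfl⟩
  have himage : (U '' {i | (U i).Nonempty}).Finite :=
    hrange.subset ((image_subset_range _ _).trans (subset_insert _ _))
  -- The cover only counts distinct sets; a nonempty set cannot repeat infinitely often, since each
  -- of its points lies in finitely many `U j`.
  refine Set.Finite.of_finite_fibers U himage ?_
  rintro _ ⟨i, ⟨x, hx⟩, rfl⟩
  refine (hf.point_finite x).subset ?_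
  rintro j ⟨-, hj⟩
  have hj' : U j = U i := hj
  change x ∈ U j
  rwa [hj']

end Spaces

/-! ### Elements of the Brandt extension as matrices -/

namespace Brandt

variable {ι S : Type u}

section Zero

variable [Zero S]

open Classical in
/-- The `(α, β)` entry of an element of the Brandt extension, seen as a matrix. -/
noncomputable def coord (α β : ι) : Brandt ι S → S
  | zero => 0
  | elem γ s _ δ => if γ = α ∧ δ = β then s else 0

@[simp]
theorem coord_zero (α β : ι) : coord α β (0 : Brandt ι S) = 0 := rfl

open Classical in
theorem coord_entry (α β γ δ : ι) (s : S) :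
    coord α β (entry γ s δ) = if γ = α ∧ δ = β then s else 0 := by
  by_cases hs : s = 0
  · simp [entry, hs]
  · simp [entry, hs, coord]

@[simp]
theorem coord_entry_self (α β : ι) (s : S) : coord α β (entry α s β) = s := by
  simp [coord_entry]

theorem coord_entry_of_ne {α β γ δ : ι} (h : ¬ (γ = α ∧ δ = β)) (s : S) :
    coord α β (entry γ s δ) = 0 := by
  simp [coord_entry, h]

@[simp]
theorem entry_zero' (α β : ι) : entry α (0 : S) β = 0 := by
  simp [entry]

theorem eq_zero_or_entry (x : Brandt ι S) :
    x = 0 ∨ ∃ α s β, s ≠ 0 ∧ x = entry α s β := by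
  rcases x with _ | ⟨α, s, hs, β⟩
  · exact Or.inl rfl
  · exact Or.inr ⟨α, s, β, hs, by simp [entry, hs]⟩

theorem entry_coord {α β : ι} {x : Brandt ι S} (h : coord α β x ≠ 0) :
    entry α (coord α β x) β = x := by
  rcases eq_zero_or_entry x with rfl | ⟨γ, s, δ, -, rfl⟩
  · exact absurd rfl h
  · by_cases hc : γ = α ∧ δ = β
    · obtain ⟨rfl, rfl⟩ := hc
      rw [coord_entry_self]
    · exact absurd (coord_entry_of_ne hc s) h

theorem exists_coord_ne_zero {x : Brandt ι S} (h : x ≠ 0) : ∃ α β, coord α β x ≠ 0 := by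
  rcases eq_zero_or_entry x with rfl | ⟨γ, s, δ, hs, rfl⟩
  · exact absurd rfl h
  · exact ⟨γ, δ, by rwa [coord_entry_self]⟩

theorem entry_injective (α β : ι) : Function.Injective fun s : S => entry α s β :=
  fun s t h => by simpa using congrArg (coord α β) h

theorem entry_eq_zero_iff {α β : ι} {s : S} : entry α s β = 0 ↔ s = 0 :=
  ⟨fun h => by simpa using congrArg (coord α β) h, fun h => by rw [h, entry_zero']⟩

theorem ext_coord {x y : Brandt ι S} (h : ∀ α β, coord α β x = coord α β y) : x = y := by
  by_cases hx : x = 0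
  · subst hx
    by_contra hy
    obtain ⟨α, β, hab⟩ := exists_coord_ne_zero (Ne.symm hy)
    exact hab (h α β).symm
  · obtain ⟨α, β, hab⟩ := exists_coord_ne_zero hx
    rw [← entry_coord hab, h α β, entry_coord (h α β ▸ hab)]

/-- The topology on the Brandt extension in which the matrix entries are the coordinates. -/
@[reducible]
noncomputable def coordTopology (ι S : Type u) [Zero S] [TopologicalSpace S] : TopologicalSpace (Brandt ι S) :=
  ⨅ p : ι × ι, TopologicalSpace.induced (coord p.1 p.2) ‹_›

end Zero

open Classical in
theorem coord_entry_mul [MonoidWithZero S] (α β γ δ : ι) (s : S) (x : Brandt ι S) :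
    coord γ δ (entry α s β * x) = if α = γ then s * coord β δ x else 0 := by
  rcases eq_zero_or_entry x with rfl | ⟨μ, t, ν, -, rfl⟩
  · simp
  · by_cases h : β = μ
    · subst h
      rw [entry_mul_entry_same, coord_entry, coord_entry]
      by_cases h1 : α = γ <;> by_cases h2 : ν = δ <;> simp [h1, h2]
    · rw [entry_mul_entry_of_ne _ _ _ _ h, coord_entry, coord_zero]
      simp [Ne.symm h]

open Classical in
theorem coord_mul_entry [MonoidWithZero S] (α β γ δ : ι) (s : S) (x : Brandt ι S) :
    coord γ δ (x * entry α s β) = if β = δ then coord γ α x * s else 0 := by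
  rcases eq_zero_or_entry x with rfl | ⟨μ, t, ν, -, rfl⟩
  · simp
  · by_cases h : ν = α
    · subst h
      rw [entry_mul_entry_same, coord_entry, coord_entry]
      by_cases h1 : β = δ <;> by_cases h2 : μ = γ <;> simp [h1, h2]
    · rw [entry_mul_entry_of_ne _ _ _ _ h, coord_entry, coord_zero]
      simp [h]

/-- Sandwiching isolates one matrix entry and moves it to any chosen block; with `s = t = 1` this is
how continuity passes between blocks. -/
theorem entry_mul_mul_entry [MonoidWithZero S] (α β γ δ : ι) (s t : S) (x : Brandt ι S) :
    entry α s β * x * entry γ t δ = entry α (s * coord β γ x * t) δ := by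
  refine ext_coord fun μ ν => ?_
  rw [coord_mul_entry, coord_entry_mul, coord_entry]
  by_cases h1 : α = μ <;> by_cases h2 : δ = ν <;> simp [h1, h2]

/-! ### Existence: the coordinate topology is admissible -/

section Topology

variable [MonoidWithZero S] [TopologicalSpace S]

section

attribute [local instance] coordTopology

theorem continuous_coord (α β : ι) : Continuous (coord α β : Brandt ι S → S) :=
  continuous_iff_le_induced.2 (iInf_le _ (α, β))

theorem preimage_coord_mem_nhds {α β : ι} {x : Brandt ι S} {V : Set S} (hV : IsOpen V)
    (hx : coord α β x ∈ V) : coord α β ⁻¹' V ∈ 𝓝 x :=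
  (hV.preimage (continuous_coord α β)).mem_nhds hx

theorem continuous_of_coord {Y : Type*} [TopologicalSpace Y] {f : Y → Brandt ι S}
    (h : ∀ α β, Continuous fun y => coord α β (f y)) : Continuous f :=
  continuous_iInf_rng.2 fun p => continuous_induced_rng.2 (h p.1 p.2)

theorem continuous_entry (α β : ι) : Continuous fun s : S => (entry α s β : Brandt ι S) := by
  refine continuous_of_coord fun γ δ => ?_
  by_cases h : α = γ ∧ β = δ
  · simpa [coord_entry, h] using continuous_id'
  · simpa [coord_entry, h] using continuous_const

theorem isInducing_entry (α β : ι) :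
    IsInducing fun s : S => (entry α s β : Brandt ι S) :=
  IsInducing.of_comp (continuous_entry α β) (continuous_coord α β)
    (by convert IsInducing.id using 1; ext s; simp)

theorem t2Space_coordTopology [T2Space S] : T2Space (Brandt ι S) := by
  refine ⟨fun x y hxy => ?_⟩
  obtain ⟨α, β, h⟩ : ∃ α β, coord α β x ≠ coord α β y := by
    by_contra! H
    exact hxy (ext_coord H)
  obtain ⟨U, V, hU, hV, hx, hy, hd⟩ := t2_separation h
  exact ⟨_, _, hU.preimage (continuous_coord α β), hV.preimage (continuous_coord α β), hx, hy,
    hd.preimage _⟩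

theorem separatelyContinuousMul_coordTopology [SeparatelyContinuousMul S] :
    SeparatelyContinuousMul (Brandt ι S) where
  continuous_const_mul {a} := by
    rcases eq_zero_or_entry a with rfl | ⟨α, s, β, -, rfl⟩
    · simpa using continuous_const
    · refine continuous_of_coord fun γ δ => ?_
      simp only [coord_entry_mul]
      split_ifs
      · exact (continuous_coord β δ).const_mul s
      · exact continuous_const
  continuous_mul_const {a} := by
    rcases eq_zero_or_entry a with rfl | ⟨α, s, β, -, rfl⟩
    · simpa using continuous_const
    · refine continuous_of_coord fun γ δ => ?_
      simp only [coord_mul_entry]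
      split_ifs
      · exact (continuous_coord γ α).mul_const s
      · exact continuous_const

/-- Inside the block `(α, β)`, `0` included, regularity is pulled back along the block inclusion
(`key`). If `0 ∉ U`, the preimage of `U` lies in that block without `0`, and a nonzero point of
another block has a neighbourhood missing it. -/
theorem interior_closure_preimage_coord [T2Space S] (α β : ι) {U : Set S}
    (hU : interior (closure U) = U) :
    interior (closure (coord α β ⁻¹' U)) ⊆ (coord α β ⁻¹' U : Set (Brandt ι S)) := by
  intro x hx
  have key : ∀ s, entry α s β ∈ interior (closure (coord α β ⁻¹' U : Set (Brandt ι S))) →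
      s ∈ U := by
    intro s hs
    rw [← hU, mem_interior]
    refine ⟨(fun s => entry α s β) ⁻¹' interior (closure (coord α β ⁻¹' U)), fun t ht => ?_,
      isOpen_interior.preimage (continuous_entry α β), hs⟩
    have h1 := (continuous_coord α β).closure_preimage_subset U (interior_subset ht)
    simpa using h1
  by_cases h : coord α β x = 0
  · change coord α β x ∈ U
    rw [h]
    by_contra h0
    by_cases hx0 : x = 0
    · exact h0 (key 0 (by rwa [entry_zero', ← hx0]))
    · obtain ⟨γ, δ, hc⟩ := exists_coord_ne_zero hx0
      have hopen : IsOpen (coord γ δ ⁻¹' {0}ᶜ : Set (Brandt ι S)) :=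
        isOpen_compl_singleton.preimage (continuous_coord γ δ)
      obtain ⟨y, hy, hyU⟩ := mem_closure_iff.1 (interior_subset hx) _ hopen hc
      have hy0 : coord α β y ≠ 0 := fun h' => h0 (h' ▸ hyU)
      have hy' : coord γ δ y ≠ 0 := hy
      rw [← entry_coord hy0] at hy'
      have : α = γ ∧ β = δ := by
        by_contra hne
        exact hy' (coord_entry_of_ne hne _)
      rw [this.1, this.2] at h
      exact hc h
  · exact key _ (by rwa [entry_coord h])

theorem exists_finite_of_mem_open {W : Set (Brandt ι S)} (hW : IsOpen W) {x : Brandt ι S}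
    (hx : x ∈ W) : ∃ (A : Set (ι × ι)) (U : ι × ι → Set S), A.Finite ∧
      (∀ p, IsOpen (U p) ∧ coord p.1 p.2 x ∈ U p) ∧
      (⋂ p ∈ A, coord p.1 p.2 ⁻¹' U p) ⊆ W := by
  have h := hW.mem_nhds hx
  rw [nhds_iInf, Filter.mem_iInf'] at h
  obtain ⟨A, hA, V, hV, -, rfl, -⟩ := h
  have : ∀ p, ∃ U : Set S, IsOpen U ∧ coord p.1 p.2 x ∈ U ∧ coord p.1 p.2 ⁻¹' U ⊆ V p := by
    intro p
    have hp := hV p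
    rw [nhds_induced, Filter.mem_comap] at hp
    obtain ⟨t, ht, htV⟩ := hp
    obtain ⟨U, hUt, hU, hxU⟩ := mem_nhds_iff.1 ht
    exact ⟨U, hU, hxU, (preimage_mono hUt).trans htV⟩
  choose U hU hxU hUV using this
  exact ⟨A, U, hA, fun p => ⟨hU p, hxU p⟩, iInter₂_mono fun p _ => hUV p⟩

/-- Only finitely many coordinates are constrained, and the regular open sets can be chosen
coordinate by coordinate. -/
theorem isSemiregular_coordTopology [T2Space S] (hS : IsSemiregular S) :
    IsSemiregular (Brandt ι S) := by
  rw [isSemiregular_iff]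
  intro x W hW hx
  obtain ⟨A, U, hA, hU, hUW⟩ := exists_finite_of_mem_open hW hx
  choose O hO hxO hOU using fun p =>
    isSemiregular_iff.1 hS (coord p.1 p.2 x) (U p) (hU p).1 (hU p).2
  have hsub : ∀ p, O p ⊆ interior (closure (O p)) := fun p => (hO p).subset_interior_closure
  refine ⟨⋂ p ∈ A, coord p.1 p.2 ⁻¹' interior (closure (O p)), ?_, ?_, ?_⟩
  · exact hA.isOpen_biInter fun p _ => isOpen_interior.preimage (continuous_coord _ _)
  · exact mem_iInter₂.2 fun p _ => hsub p (hxO p)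
  · refine Subset.trans (subset_iInter₂ fun p hp => ?_) hUW
    refine (interior_mono (closure_mono (iInter₂_subset p hp))).trans ?_
    exact (interior_closure_preimage_coord _ _ interior_closure_idem).trans
      (preimage_mono (hOU p))

/-- A member of the cover either meets a neighbourhood of `0` that meets finitely many members, or
meets one of the finitely many blocks not inside that neighbourhood. Each block meets finitely many
members because `S` is pseudocompact. -/
theorem isPseudocompact_coordTopology (hS : IsPseudocompact S) :
    IsPseudocompact (Brandt ι S) := by
  intro 𝒰 hopen hcover hlf
  have hblock : ∀ p : ι × ι, {V : 𝒰 | ∃ s, entry p.1 s p.2 ∈ (V : Set (Brandt ι S))}.Finite :=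
    fun p => hS.finite_nonempty
      (U := fun V : 𝒰 => (fun s => entry p.1 s p.2) ⁻¹' (V : Set (Brandt ι S)))
      (fun V => (hopen V V.2).preimage (continuous_entry p.1 p.2))
      (hlf.preimage_continuous (continuous_entry p.1 p.2))
  obtain ⟨N, hN, hfin⟩ := hlf 0
  obtain ⟨W, hWN, hW, h0⟩ := mem_nhds_iff.1 hN
  obtain ⟨A, U, hA, hU, hUW⟩ := exists_finite_of_mem_open hW h0
  have hall : ({V : 𝒰 | (V : Set (Brandt ι S)).Nonempty}).Finite := by
    refine (hfin.union (hA.biUnion fun p _ => hblock p)).subset ?_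
    rintro V ⟨x, hx⟩
    by_cases hxN : x ∈ N
    · exact Or.inl ⟨x, hx, hxN⟩
    · right
      have hx' : x ∉ ⋂ p ∈ A, coord p.1 p.2 ⁻¹' U p := fun h => hxN (hWN (hUW h))
      simp only [mem_iInter, not_forall] at hx'
      obtain ⟨p, hp, hxp⟩ := hx'
      have hne : coord p.1 p.2 x ≠ 0 := fun h => hxp (by
        change coord p.1 p.2 x ∈ U p
        rw [h]
        exact (hU p).2)
      exact mem_iUnion₂.2 ⟨p, hp, coord p.1 p.2 x, by rwa [entry_coord hne]⟩
  refine ((hall.image Subtype.val).insert ∅).subset fun V hV => ?_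
  rcases V.eq_empty_or_nonempty with rfl | hne
  · exact mem_insert _ _
  · exact mem_insert_of_mem _ ⟨⟨V, hV⟩, hne, rfl⟩

end

theorem isBrandtExtension_coordTopology [T2Space S] [SeparatelyContinuousMul S]
    (hS : IsSemiregular S) (hS' : IsPseudocompact S) [Nonempty ι] :
    IsBrandtExtension S ι (coordTopology ι S) :=
  { t2 := t2Space_coordTopology
    separatelyContinuous := separatelyContinuousMul_coordTopology
    semiregular := isSemiregular_coordTopology hS
    pseudocompact := isPseudocompact_coordTopology hS'
    inducing := ⟨Classical.arbitrary ι, isInducing_entry _ _⟩ }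

end Topology

end Brandt

/-! ### Uniqueness of the admissible topology -/

namespace IsBrandtExtension

open Brandt

variable {ι S : Type u} [MonoidWithZero S] [TopologicalSpace S] {σ : TopologicalSpace (Brandt ι S)}

theorem continuous_coord (h : IsBrandtExtension S ι σ) (α β : ι) :
    Continuous (coord α β : Brandt ι S → S) := by
  obtain ⟨γ, hγ⟩ := h.inducing
  have := h.separatelyContinuous
  -- Continuity into `S` is tested in the one diagonal block known to carry the topology of `S`.
  rw [hγ.continuous_iff]
  have : Continuous fun x : Brandt ι S => entry γ 1 α * x * entry β 1 γ :=
    (continuous_id.const_mul _).mul_const _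
  simpa only [entry_mul_mul_entry, one_mul, mul_one, Function.comp_def] using this

theorem continuous_entry (h : IsBrandtExtension S ι σ) (α β : ι) :
    Continuous fun s : S => (entry α s β : Brandt ι S) := by
  obtain ⟨γ, hγ⟩ := h.inducing
  have := h.separatelyContinuous
  have : Continuous fun s : S => (entry α 1 γ * entry γ s γ * entry γ 1 β : Brandt ι S) :=
    (hγ.continuous.const_mul _).mul_const _
  simpa only [entry_mul_entry_same, one_mul, mul_one] using this

/-- The parts of the punctured blocks outside `closure O` form a locally finite open family: near
`0` the set `O` misses them all, and elsewhere the punctured blocks are open and disjoint. So almost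
all parts are empty; such a punctured block is an open subset of `closure O`, hence lies in
`interior (closure O) = O`. -/
theorem finite_not_subset (h : IsBrandtExtension S ι σ) {O : Set (Brandt ι S)} [T2Space S]
    (hO : interior (closure O) = O) (h0 : 0 ∈ O) :
    {p : ι × ι | ∃ s, entry p.1 s p.2 ∉ O}.Finite := by
  have hcopen : ∀ p : ι × ι, IsOpen (coord p.1 p.2 ⁻¹' {0}ᶜ : Set (Brandt ι S)) := fun p =>
    isOpen_compl_singleton.preimage (h.continuous_coord p.1 p.2)
  have hOo : IsOpen O := hO ▸ isOpen_interior
  have hfin := h.pseudocompact.finite_nonempty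
    (U := fun p : ι × ι => coord p.1 p.2 ⁻¹' {0}ᶜ ∩ (closure O)ᶜ)
    (fun p => (hcopen p).inter isClosed_closure.isOpen_compl) (by
      intro x
      by_cases hx : x = 0
      · refine ⟨O, hOo.mem_nhds (hx ▸ h0), ?_⟩
        convert Set.finite_empty
        rw [eq_empty_iff_forall_notMem]
        rintro p ⟨y, ⟨-, hy⟩, hyO⟩
        exact hy (subset_closure hyO)
      · obtain ⟨α, β, hc⟩ := exists_coord_ne_zero hx
        refine ⟨_, (hcopen (α, β)).mem_nhds hc, (Set.finite_singleton (α, β)).subset ?_⟩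
        rintro ⟨γ, δ⟩ ⟨y, ⟨hy, -⟩, hy'⟩
        by_contra hne
        rw [← entry_coord hy] at hy'
        exact hy' (coord_entry_of_ne (fun he => hne (Prod.ext he.1 he.2)) _))
  refine hfin.subset ?_
  rintro ⟨α, β⟩ ⟨s, hs⟩
  by_contra hemp
  rw [mem_ofPred_eq, not_nonempty_iff_eq_empty] at hemp
  have hs0 : s ≠ 0 := fun hs0 => hs (by simpa [hs0] using h0)
  apply hs
  rw [← hO, mem_interior]
  refine ⟨_, ?_, hcopen (α, β), by simpa using hs0⟩
  intro y hy
  by_contra hyO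
  exact notMem_empty y (hemp ▸ ⟨hy, hyO⟩)

theorem eq_coordTopology (h : IsBrandtExtension S ι σ) [T2Space S] : σ = coordTopology ι S := by
  apply le_antisymm
  · exact le_iInf fun p => continuous_iff_le_induced.1 (h.continuous_coord p.1 p.2)
  · intro W hW
    rw [@isOpen_iff_mem_nhds _ (coordTopology ι S)]
    intro x hx
    by_cases hx0 : x = 0
    · subst hx0
      obtain ⟨O', hO', h0', hOW⟩ := isSemiregular_iff.1 h.semiregular 0 W hW hx
      set O := interior (closure O') with hOdef
      have h0 : (0 : Brandt ι S) ∈ O := hO'.subset_interior_closure h0'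
      have hA := h.finite_not_subset (O := O) interior_closure_idem h0
      -- Only the finitely many blocks not contained in `O` need a constraint.
      refine mem_of_superset (x := ⋂ p ∈ {p : ι × ι | ∃ s, entry p.1 s p.2 ∉ O},
        coord p.1 p.2 ⁻¹' ((fun s => entry p.1 s p.2) ⁻¹' O)) ?_ ?_
      · refine (Filter.biInter_mem hA).2 fun p _ => ?_
        refine preimage_coord_mem_nhds
          (isOpen_interior.preimage (h.continuous_entry p.1 p.2)) ?_
        simpa using h0
      · intro y hy
        refine hOW ?_
        by_contra hyO
        have hy0 : y ≠ 0 := fun hy0 => hyO (hy0 ▸ h0)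
        obtain ⟨α, β, hc⟩ := exists_coord_ne_zero hy0
        have := mem_iInter₂.1 hy (α, β) ⟨coord α β y, by rwa [entry_coord hc]⟩
        rw [mem_preimage, mem_preimage, entry_coord hc] at this
        exact hyO this
    · obtain ⟨α, β, hc⟩ := exists_coord_ne_zero hx0
      -- Removing `0` keeps the neighbourhood inside the block, where an element is recovered from
      -- its coordinate.
      refine mem_of_superset (x := coord α β ⁻¹' ((fun s => entry α s β) ⁻¹' W ∩ {0}ᶜ)) ?_ ?_
      · refine preimage_coord_mem_nhds
          ((hW.preimage (h.continuous_entry α β)).inter isOpen_compl_singleton) ?_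
        exact ⟨by rwa [mem_preimage, entry_coord hc], hc⟩
      · rintro y ⟨hy, hy0⟩
        rwa [mem_preimage, entry_coord hy0] at hy

end IsBrandtExtension

/-! ### Inverses in maximal subgroups -/

section MaxSubgroup

variable {T : Type u} [Semigroup T] {e x y z : T}

theorem isInvAt_invAt (hx : x ∈ maxSubgroup e) : IsInvAt e x (invAt e x) := by
  rw [invAt, dif_pos hx.2.2]
  exact hx.2.2.choose_spec

theorem IsInvAt.unique (hy : IsInvAt e x y) (hz : IsInvAt e x z) : y = z := by
  calc y = e * y := hy.1.symm
    _ = z * x * y := by rw [hz.2.2.2]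
    _ = z := by rw [mul_assoc, hy.2.2.1, hz.2.1]

theorem IsInvAt.invAt_eq (hy : IsInvAt e x y) (hx : x ∈ maxSubgroup e) : invAt e x = y :=
  (isInvAt_invAt hx).unique hy

end MaxSubgroup

/-! ### Functoriality of the Brandt map -/

namespace TPCB

open Brandt

variable {X Y Z : TPCB.{u}}

namespace Triple

theorem brandtMap_zero (p : Triple X Y) : p.brandtMap 0 = 0 := rfl

/-- The case split disappears, because `entry` already reads a zero middle term as `0`. -/
theorem brandtMap_entry (p : Triple X Y) (α β : X.index) (s : X.S) :
    p.brandtMap (entry α s β) =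
      entry (p.φ α) (p.u α * p.h s * invAt (p.h 1) (p.u β)) (p.φ β) := by
  by_cases hs : s = 0
  · rw [hs, entry_zero', p.h.map_zero, mul_zero, zero_mul, entry_zero', brandtMap_zero]
  · rw [← elem_eq_entry α s hs]
    by_cases h : p.h s = 0
    · simp [brandtMap, h]
    · simp [brandtMap, h]

theorem brandtMap_mul (p : Triple X Y) (x y : Brandt X.index X.S) :
    p.brandtMap (x * y) = p.brandtMap x * p.brandtMap y := by
  rcases eq_zero_or_entry x with rfl | ⟨α, s, β, -, rfl⟩
  · simp [brandtMap_zero]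
  rcases eq_zero_or_entry y with rfl | ⟨γ, t, δ, -, rfl⟩
  · simp [brandtMap_zero]
  by_cases h : β = γ
  · subst h
    have hu := (isInvAt_invAt (p.u_mem β)).2.2.2
    rw [entry_mul_entry_same, brandtMap_entry, brandtMap_entry, brandtMap_entry,
      entry_mul_entry_same]
    congr 1
    calc p.u α * p.h (s * t) * invAt (p.h 1) (p.u δ)
        = p.u α * p.h s * (p.h 1 * p.h t) * invAt (p.h 1) (p.u δ) := by
          rw [← p.h.map_mul, one_mul, p.h.map_mul]
          simp only [mul_assoc]
      -- The inserted `h 1` is `u(β)⁻¹ u(β)`.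
      _ = p.u α * p.h s * invAt (p.h 1) (p.u β) * (p.u β * p.h t * invAt (p.h 1) (p.u δ)) := by
          simp only [← mul_assoc]
          rw [mul_assoc _ (invAt _ _) (p.u β), hu]
  · rw [entry_mul_entry_of_ne _ _ _ _ h, brandtMap_entry, brandtMap_entry, brandtMap_zero,
      entry_mul_entry_of_ne _ _ _ _ (p.φ_inj.ne h)]

theorem brandtMap_id (x : Brandt X.index X.S) : (id X).brandtMap x = x := by
  rcases eq_zero_or_entry x with rfl | ⟨α, s, β, -, rfl⟩
  · rfl
  · rw [brandtMap_entry]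
    have h : IsInvAt (1 : X.S) 1 1 := by simp [IsInvAt]
    change entry α (1 * s * invAt 1 1) β = _
    rw [h.invAt_eq ⟨one_mul 1, one_mul 1, 1, h⟩, one_mul, mul_one]

/-- The factors are inverted at different idempotents, `q.h 1` and `q.h (p.h 1)`; the second is
central and absorbs the first. -/
theorem isInvAt_comp (p : Triple X Y) (q : Triple Y Z) (α : X.index) :
    IsInvAt ((p.comp q).h 1) ((p.comp q).u α)
      (q.h (invAt (p.h 1) (p.u α)) * invAt (q.h 1) (q.u (p.φ α))) := by
  obtain ⟨-, -, a5, a6⟩ := isInvAt_invAt (q.u_mem (p.φ α))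
  obtain ⟨a3, a4, -, -⟩ := isInvAt_invAt (q.u_mem (p.φ α))
  obtain ⟨b3, b4, b5, b6⟩ := isInvAt_invAt (p.u_mem α)
  change IsInvAt (q.h (p.h 1)) (q.u (p.φ α) * q.h (p.u α)) _
  have hc := Z.central (q.h (p.h 1)) (by rw [← q.h.map_mul, ← p.h.map_mul, one_mul])
  have hone : ∀ y, q.h 1 * q.h y = q.h y := fun y => by rw [← q.h.map_mul, one_mul]
  refine ⟨?_, ?_, ?_, ?_⟩
  · rw [← mul_assoc, ← q.h.map_mul, b3]
  · rw [mul_assoc, ← hc, ← mul_assoc, ← q.h.map_mul, b4]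
  · rw [mul_assoc, ← mul_assoc (q.h (p.u α)), ← q.h.map_mul, b5, hc, ← mul_assoc, a5, hone]
  · rw [mul_assoc, ← mul_assoc _ (q.u _), a6, hone, ← q.h.map_mul, b6]

theorem brandtMap_comp (p : Triple X Y) (q : Triple Y Z) (x : Brandt X.index X.S) :
    (p.comp q).brandtMap x = q.brandtMap (p.brandtMap x) := by
  rcases eq_zero_or_entry x with rfl | ⟨α, s, β, -, rfl⟩
  · rfl
  · rw [brandtMap_entry, brandtMap_entry, brandtMap_entry,
      (isInvAt_comp p q β).invAt_eq ((p.comp q).u_mem β), q.h.map_mul, q.h.map_mul]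
    change entry _ (q.u _ * q.h _ * q.h (p.h s) * _) _ = _
    simp only [mul_assoc]
    rfl

theorem brandtMap_of_not_isNontrivial {p : Triple X Y} (hp : ¬ p.IsNontrivial)
    (x : Brandt X.index X.S) : p.brandtMap x = 0 := by
  rcases eq_zero_or_entry x with rfl | ⟨α, s, β, -, rfl⟩
  · rfl
  · have hs : p.h s = 0 := by
      by_contra hs
      exact hp ⟨s, hs⟩
    rw [brandtMap_entry, hs, mul_zero, zero_mul, entry_zero']

end Triple

theorem brandtMap_ofTriple (p : Triple X Y) :
    brandtMap (X := X) (Y := Y) (Hom.ofTriple p) = p.brandtMap := by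
  by_cases hp : p.IsNontrivial
  · rw [← Hom.triple_eq p hp]
    rfl
  · rw [Hom.ofTriple, dif_neg hp]
    funext x
    exact (Triple.brandtMap_of_not_isNontrivial hp x).symm

theorem Hom.eq_zero_or_ofTriple (f : X ⟶ Y) :
    f = Hom.zero ∨ ∃ p : Triple X Y, p.IsNontrivial ∧ f = Hom.ofTriple p := by
  match f with
  | Hom.zero => exact Or.inl rfl
  | Hom.triple p hp => exact Or.inr ⟨p, hp, Hom.triple_eq p hp⟩

theorem brandtMap_map_zero (f : X ⟶ Y) : brandtMap f 0 = 0 := by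
  match f with
  | Hom.zero => rfl
  | Hom.triple _ _ => rfl

theorem brandtMap_map_mul (f : X ⟶ Y) (x y : Brandt X.index X.S) :
    brandtMap f (x * y) = brandtMap f x * brandtMap f y := by
  match f with
  | Hom.zero => exact (mul_zero _).symm
  | Hom.triple p _ => exact p.brandtMap_mul x y

theorem brandtMap_id (x : Brandt X.index X.S) : brandtMap (𝟙 X) x = x := by
  change brandtMap (X := X) (Y := X) (Hom.ofTriple (Triple.id X)) x = x
  rw [brandtMap_ofTriple, Triple.brandtMap_id]

theorem brandtMap_comp (f : X ⟶ Y) (g : Y ⟶ Z) (x : Brandt X.index X.S) :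
    brandtMap (f ≫ g) x = brandtMap g (brandtMap f x) := by
  rcases Hom.eq_zero_or_ofTriple f with rfl | ⟨p, -, rfl⟩
  · change brandtMap (X := X) (Y := Z) (Hom.comp Hom.zero g) x = brandtMap g 0
    rw [Hom.zero_comp, brandtMap_map_zero]
    rfl
  rcases Hom.eq_zero_or_ofTriple g with rfl | ⟨q, -, rfl⟩
  · change brandtMap (X := X) (Y := Z) (Hom.comp (Hom.ofTriple p) Hom.zero) x = 0
    rw [Hom.comp_zero]
    rfl
  · change brandtMap (X := X) (Y := Z) (Hom.comp (Hom.ofTriple p) (Hom.ofTriple q)) x = _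
    rw [Hom.ofTriple_comp, brandtMap_ofTriple, brandtMap_ofTriple, brandtMap_ofTriple,
      Triple.brandtMap_comp]

/-! ### Continuity and fullness -/

section Topology

attribute [local instance] coordTopology

/-- Since `φ` is injective, at most one block lands in a given block, so each coordinate of the
image is zero or depends on a single coordinate of `x`. -/
theorem Triple.continuous_brandtMap (p : Triple X Y) : Continuous p.brandtMap := by
  refine continuous_of_coord fun γ δ => ?_
  by_cases h : ∃ α β, p.φ α = γ ∧ p.φ β = δ
  · obtain ⟨α, β, rfl, rfl⟩ := h
    have : (fun x => coord (p.φ α) (p.φ β) (p.brandtMap x)) =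
        fun x => p.u α * p.h (coord α β x) * invAt (p.h 1) (p.u β) := by
      funext x
      rcases eq_zero_or_entry x with rfl | ⟨γ, s, δ, -, rfl⟩
      · simp [brandtMap_zero, p.h.map_zero]
      · rw [brandtMap_entry]
        by_cases hc : γ = α ∧ δ = β
        · obtain ⟨rfl, rfl⟩ := hc
          simp
        · rw [coord_entry_of_ne hc, p.h.map_zero, mul_zero, zero_mul, coord_entry_of_ne]
          exact fun ⟨h1, h2⟩ => hc ⟨p.φ_inj h1, p.φ_inj h2⟩
    rw [this]
    exact ((p.h.continuous.comp (continuous_coord α β)).const_mul _).mul_const _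
  · convert continuous_const (y := (0 : Y.S)) using 2 with x
    rcases eq_zero_or_entry x with rfl | ⟨α, s, β, -, rfl⟩
    · simp [brandtMap_zero]
    · rw [brandtMap_entry, coord_entry_of_ne]
      exact fun hc => h ⟨α, β, hc⟩

theorem continuous_brandtMap (f : X ⟶ Y) : Continuous (brandtMap f) := by
  match f with
  | Hom.zero => exact continuous_const
  | Hom.triple p _ => exact p.continuous_brandtMap

/-- The homomorphism of Brandt extensions given by a morphism of pairs. -/
noncomputable def brandtHom (f : X ⟶ Y) :
    CHom₀ (Brandt X.index X.S) (Brandt Y.index Y.S) where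
  toFun := brandtMap f
  map_mul := brandtMap_map_mul f
  map_zero := brandtMap_map_zero f
  continuous := continuous_brandtMap f

theorem exists_brandtMap_eq (f : CHom₀ (Brandt X.index X.S) (Brandt Y.index Y.S)) :
    ∃ g : X ⟶ Y, brandtMap g = f.toFun := by
  by_cases hf : ∀ x, f x = 0
  · exact ⟨Hom.zero, funext fun x => (hf x).symm⟩
  have hidem : ∀ α, f (entry α 1 α) * f (entry α 1 α) = f (entry α 1 α) := fun α => by
    rw [← f.map_mul, entry_mul_entry_same, one_mul]
  -- Every element factors through `(α, 1, α)`, so killing one such idempotent kills everything.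
  have hne : ∀ α, f (entry α 1 α) ≠ 0 := by
    intro α hα
    refine hf fun x => ?_
    rcases eq_zero_or_entry x with rfl | ⟨β, s, γ, -, rfl⟩
    · exact f.map_zero
    · have : (entry β s γ : Brandt X.index X.S) = entry β s α * entry α 1 α * entry α 1 γ := by
        rw [entry_mul_entry_same, entry_mul_entry_same, mul_one, mul_one]
      rw [this, f.map_mul, f.map_mul, hα, mul_zero, zero_mul]
  -- An off-diagonal element squares to `0`, so a nonzero idempotent is diagonal.
  have hdiag : ∀ α, ∃ γ e, e ≠ 0 ∧ e * e = e ∧ f (entry α 1 α) = entry γ e γ := by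
    intro α
    rcases eq_zero_or_entry (f (entry α 1 α)) with h | ⟨γ, e, δ, he, h⟩
    · exact absurd h (hne α)
    have h2 := hidem α
    rw [h] at h2
    by_cases hd : δ = γ
    · subst hd
      rw [entry_mul_entry_same] at h2
      exact ⟨δ, e, he, entry_injective δ δ h2, h⟩
    · rw [entry_mul_entry_of_ne _ _ _ _ hd] at h2
      exact absurd (entry_eq_zero_iff.1 h2.symm) he
  choose φ e he hee hfe using hdiag
  have hblock : ∀ α s β, f (entry α s β) =
      entry (φ α) (e α * coord (φ α) (φ β) (f (entry α s β)) * e β) (φ β) := by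
    intro α s β
    rw [← entry_mul_mul_entry, ← hfe, ← hfe, ← f.map_mul, ← f.map_mul, entry_mul_entry_same,
      entry_mul_entry_same, one_mul, mul_one]
  have hc := fun α => Y.central (e α) (hee α)
  have hinj : Function.Injective φ := by
    intro α β h
    by_contra hab
    -- If `φ α = φ β`, orthogonality of the two idempotents passes to `Y.S`; by centrality it kills
    -- the image of `(α, 1, β)`, through which `(α, 1, α)` factors.
    have h0 : e α * e β = 0 := by
      have : f (entry α 1 α * entry β 1 β) = 0 := by
        rw [entry_mul_entry_of_ne _ _ _ _ hab, f.map_zero]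
      rw [f.map_mul, hfe, hfe, h, entry_mul_entry_same] at this
      exact entry_eq_zero_iff.1 this
    have h1 : f (entry α 1 β) = 0 := by
      rw [hblock, hc α, mul_assoc, h0, mul_zero, entry_zero']
    apply hne α
    rw [← one_mul (1 : X.S), ← entry_mul_entry_same α β α, f.map_mul, h1, zero_mul]
  obtain ⟨o⟩ := X.nonempty
  set c : X.index → X.S → X.index → Y.S :=
    fun α s β => coord (φ α) (φ β) (f (entry α s β)) with hcdef
  have hfc : ∀ α s β, f (entry α s β) = entry (φ α) (c α s β) (φ β) := by
    intro α s β
    have h1 := hblock α s β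
    have h2 := congrArg (coord (φ α) (φ β)) h1
    rw [coord_entry_self] at h2
    rw [h1, ← h2]
  have hmul : ∀ α s β t δ, c α (s * t) δ = c α s β * c β t δ := by
    intro α s β t δ
    have : f (entry α (s * t) δ) = f (entry α s β) * f (entry β t δ) := by
      rw [← f.map_mul, entry_mul_entry_same]
    rw [hfc, hfc, hfc, entry_mul_entry_same] at this
    exact entry_injective _ _ this
  have hce : ∀ α, c α 1 α = e α := fun α => by
    have := hfc α 1 α
    rw [hfe] at this
    exact (entry_injective _ _ this).symm
  have hl : ∀ α s β, e α * c α s β = c α s β := fun α s β => by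
    rw [← hce, ← hmul, one_mul]
  have hr : ∀ α s β, c α s β * e β = c α s β := fun α s β => by
    rw [← hce, ← hmul, mul_one]
  have huv : ∀ α β, c α 1 β * c β 1 α = e α := fun α β => by
    rw [← hmul, one_mul, hce]
  -- `e α` factors through `c α 1 β`, on which `e β` is a right identity; being central, it can be
  -- moved there.
  have hle : ∀ α β, e β * e α = e α := fun α β => by
    rw [← huv α β, ← mul_assoc, hc β, hr]
  have heo : ∀ α, e α = e o := fun α => by
    rw [← hle α o, hc o, hle o α]
  let h : CHom₀ X.S Y.S :=
    { toFun := fun s => c o s o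
      map_mul := fun s t => hmul o s o t o
      map_zero := by simp [hcdef, f.map_zero]
      continuous := (continuous_coord _ _).comp (f.continuous.comp (continuous_entry o o)) }
  have h1 : h 1 = e o := hce o
  have hinv : ∀ α, IsInvAt (h 1) (c α 1 o) (c o 1 α) := fun α => by
    rw [h1]
    exact ⟨hl _ _ _, by rw [← heo α, hr], by rw [huv, heo], huv _ _⟩
  have hmem : ∀ α, c α 1 o ∈ maxSubgroup (h 1) := fun α =>
    ⟨by rw [h1, ← heo α, hl], by rw [h1, hr], _, hinv α⟩
  -- The choice reflects `(α, s, β) = (α, 1, o)(o, s, o)(o, 1, β)`, where the outer factor `c o 1 β`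
  -- is the inverse of `u(β)`.
  let p : Triple X Y := ⟨h, fun α => c α 1 o, hmem, φ, hinj⟩
  refine ⟨Hom.ofTriple p, ?_⟩
  rw [brandtMap_ofTriple]
  funext x
  rcases eq_zero_or_entry x with rfl | ⟨α, s, β, -, rfl⟩
  · exact f.map_zero.symm
  · rw [Triple.brandtMap_entry]
    change entry (φ α) (c α 1 o * c o s o * invAt (h 1) (c β 1 o)) (φ β) = f (entry α s β)
    rw [(hinv β).invAt_eq (hmem β), hfc, ← hmul, ← hmul, one_mul, mul_one]

end Topology

end TPCB

theorem theorem3p3 :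
    ∃ (τ : ∀ X : TPCB.{u}, TopologicalSpace (Brandt X.index X.S))
      (hτ : ∀ X : TPCB.{u}, IsBrandtExtension X.S X.index (τ X)),
      -- the topology is the only admissible one
      (∀ (X : TPCB.{u}) (σ : TopologicalSpace (Brandt X.index X.S)),
        IsBrandtExtension X.S X.index σ → σ = τ X) ∧
      ∃ (F : ∀ {X Y : TPCB.{u}}, (X ⟶ Y) →
          ((⟨X, τ X, hτ X⟩ : BTPCS.{u}) ⟶ (⟨Y, τ Y, hτ Y⟩ : BTPCS.{u})))
        (hid : ∀ X : TPCB.{u}, F (𝟙 X) = 𝟙 (⟨X, τ X, hτ X⟩ : BTPCS.{u}))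
        (hcomp : ∀ {X Y Z : TPCB.{u}} (f : X ⟶ Y) (g : Y ⟶ Z), F (f ≫ g) = F f ≫ F g),
        (∀ {X Y : TPCB.{u}} (f : X ⟶ Y), BTPCS.toMap (F f) = TPCB.brandtMap f) ∧
        let B : TPCB.{u} ⥤ BTPCS.{u} :=
          { obj := fun X => ⟨X, τ X, hτ X⟩
            map := F
            map_id := hid
            map_comp := hcomp }
        B.Full ∧ B.EssSurj := by
  refine ⟨fun X => Brandt.coordTopology X.index X.S,
    fun X => Brandt.isBrandtExtension_coordTopology X.semiregular X.pseudocompact,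
    fun X σ h => h.eq_coordTopology, fun {X Y} f => TPCB.brandtHom f,
    fun X => CHom₀.ext (funext TPCB.brandtMap_id),
    fun f g => CHom₀.ext (funext (TPCB.brandtMap_comp f g)), fun f => rfl, ?_, ?_⟩
  · refine ⟨fun f => ?_⟩
    obtain ⟨g, hg⟩ := TPCB.exists_brandtMap_eq f
    exact ⟨g, CHom₀.ext hg⟩
  · refine ⟨fun ⟨X, σ, hσ⟩ => ⟨X, ⟨eqToIso ?_⟩⟩⟩
    -- Uniqueness makes the given object equal to the image of its pair, so the isomorphism is an
    -- equality.
    obtain rfl := hσ.eq_coordTopology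
    rfl
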